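/- Let $n$ be a natural number, $A, A_m\in\mathbb R^{n\times n}$, $b,b_m\in\mathbb R^n$, with all (complex) eigenvalues of $A_m$ in the open unit disc. Assume there are $k_1^*\in\mathbb R^n$ and a nonzero $k_2^*\in\mathbb R$ with $$A+b\,k_1^{*T}=A_m,\qquad b\,k_2^*=b_m \tag{A1}$$ (the controller below uses $A_m$, $b_m$, the sign of $k_2^*$ (A2), and a number $k_2^a$ with $0<k_2^a\le|k_2^*|$ (A4), but not $A$, $b$, $k_1^*$, $k_2^*$). Let $r(t)$, $t=0,1,2,\dots$, be a bounded real reference signal, and consider the plant, the reference model and the controller $$x(t+1)=Ax(t)+bu(t),\qquad x_m(t+1)=A_mx_m(t)+b_mr(t),\qquad u(t)=k_1^T(t)x(t)+k_2(t)r(t),$$ with $x(t),x_m(t),k_1(t)\in\mathbb R^n$ and $u(t),k_2(t)\in\mathbb R$. Put $\theta(t)=[k_1^T(t),k_2(t)]^T$, $\omega(t)=[x^T(t),r(t)]^T\in\mathbb R^{n+1}$, $e(t)=x(t)-x_m(t)$. For a scalar signal $v$ let $w_{mi}(z)[v](t)$ denote the $i$-th coordinate of $s(t)$, where $s(0)=0$,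 $s(t+1)=A_ms(t)+b_mv(t)$ (that is, the output, with zero initial state, of the system with transfer function $w_{mi}(z)$, the $i$-th coordinate of $(zI-A_m)^{-1}b_m$); for a vector signal it is applied to each coordinate. For $i=1,\dots,n$ and a real signal $\rho(t)$ put $$\zeta_i(t)=w_{mi}(z)[\omega](t),\quad \xi_i(t)=\theta^T(t)\zeta_i(t)-w_{mi}(z)[\theta^T\omega](t),\quad \epsilon_i(t)=e_i(t)+\rho(t)\xi_i(t),$$ $$m(t)=\sqrt{1+\sum_{i=1}^n\zeta_i^T(t)\zeta_i(t)+\sum_{i=1}^n\xi_i^2(t)}.$$ Let the gains be updated by $$\theta(t+1)=\theta(t)-\frac{\operatorname{sign}[k_2^*]\,\Gamma\sum_{i=1}^n\epsilon_i(t)\zeta_i(t)}{m^2(t)},\qquad \rho(t+1)=\rho(t)-\frac{\gamma\sum_{i=1}^n\epsilon_i(t)\xi_i(t)}{m^2(t)},$$ where $0<\Gamma=\Gamma^T<2k_2^aI_{n+1}$ and $0<\gamma<2$. Then, for arbitrary initial values $x(0)$, $x_m(0)$, $\theta(0)$, $\rho(0)$, all closed-loop signals are bounded, namely $x$, $x_m$,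 $u$, $k_1$, $k_2$, $\rho$, $\zeta_i$, $w_{mi}(z)[\theta^T\omega]$, $\xi_i$, $\epsilon_i$ ($i=1,\dots,n$) and $m$, and $$\lim_{t\to\infty}\bigl(x(t)-x_m(t)\bigr)=0 .$$ -/

import Mathlib

open Matrix Filter Topology

noncomputable section

namespace DirectAdaptive

variable {n : ℕ}

/-- A discrete-time signal is bounded. -/
def BoundedSignal {E : Type*} [Norm E] (v : ℕ → E) : Prop :=
  ∃ C : ℝ, ∀ t, ‖v t‖ ≤ C

/-- A real matrix is stable in the discrete-time sense: all its complex eigenvalues lie in the open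
unit disc. -/
def SchurStable (M : Matrix (Fin n) (Fin n) ℝ) : Prop :=
  ∀ z ∈ spectrum ℂ (M.map (algebraMap ℝ ℂ)), ‖z‖ < 1

/-- `W(z)[v]`, where `W(z) = (zI - M)⁻¹ c`: the (zero initial state) response of the system
`s(t+1) = M s(t) + c v(t)` to the scalar input `v`. Its `i`-th coordinate is `wᵢ(z)[v]`. -/
def response (M : Matrix (Fin n) (Fin n) ℝ) (c : Fin n → ℝ) (v : ℕ → ℝ) : ℕ → Fin n → ℝ
  | 0 => 0
  | t + 1 => M *ᵥ response M c v t + v t • c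

/-- The signal `[vᵀ(t), s(t)]ᵀ` in `ℝⁿ⁺¹`. -/
def stack (v : ℕ → Fin n → ℝ) (s : ℕ → ℝ) : ℕ → Fin (n + 1) → ℝ :=
  fun t => Fin.snoc (α := fun _ => ℝ) (v t) (s t)

/-- `ζᵢ(t) = wᵢ(z)[ω](t)`, the filter being applied to each coordinate of `ω`. -/
def zeta (Am : Matrix (Fin n) (Fin n) ℝ) (bm : Fin n → ℝ) (ω : ℕ → Fin (n + 1) → ℝ)
    (i : Fin n) (t : ℕ) : Fin (n + 1) → ℝ :=
  fun j => response Am bm (fun τ => ω τ j) t i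

/-- `ξᵢ(t) = θᵀ(t) ζᵢ(t) - wᵢ(z)[θᵀ ω](t)`. -/
def xi (Am : Matrix (Fin n) (Fin n) ℝ) (bm : Fin n → ℝ) (θ ω : ℕ → Fin (n + 1) → ℝ)
    (i : Fin n) (t : ℕ) : ℝ :=
  θ t ⬝ᵥ zeta Am bm ω i t - response Am bm (fun τ => θ τ ⬝ᵥ ω τ) t i

/-- The estimation error `εᵢ(t) = eᵢ(t) + ρ(t) ξᵢ(t)`. -/
def eps (Am : Matrix (Fin n) (Fin n) ℝ) (bm : Fin n → ℝ) (θ ω : ℕ → Fin (n + 1) → ℝ)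
    (ρ : ℕ → ℝ) (e : ℕ → Fin n → ℝ) (i : Fin n) (t : ℕ) : ℝ :=
  e t i + ρ t * xi Am bm θ ω i t

/-- The normalizing signal `m(t) = √(1 + ∑ᵢ ζᵢᵀ(t) ζᵢ(t) + ∑ᵢ ξᵢ(t)²)`. -/
def normalizer (Am : Matrix (Fin n) (Fin n) ℝ) (bm : Fin n → ℝ) (θ ω : ℕ → Fin (n + 1) → ℝ)
    (t : ℕ) : ℝ :=
  √(1 + ∑ i, zeta Am bm ω i t ⬝ᵥ zeta Am bm ω i t + ∑ i, xi Am bm θ ω i t ^ 2)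

/-- The closed-loop system: plant, reference model, controller `u = k₁ᵀ x + k₂ r` and the normalized
gradient adaptive laws for `θ = [k₁ᵀ, k₂]ᵀ` and `ρ`, with `sgn` the sign used in the law for `θ`.
All initial values `x(0)`, `x_m(0)`, `k₁(0)`, `k₂(0)`, `ρ(0)` are unconstrained. -/
structure ClosedLoop (A Am : Matrix (Fin n) (Fin n) ℝ) (b bm : Fin n → ℝ)
    (Γ : Matrix (Fin (n + 1)) (Fin (n + 1)) ℝ) (γ sgn : ℝ) (r : ℕ → ℝ)
    (x xm : ℕ → Fin n → ℝ) (u : ℕ → ℝ) (k₁ : ℕ → Fin n → ℝ) (k₂ ρ : ℕ → ℝ) : Prop where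
  plant : ∀ t, x (t + 1) = A *ᵥ x t + u t • b
  model : ∀ t, xm (t + 1) = Am *ᵥ xm t + r t • bm
  control : ∀ t, u t = k₁ t ⬝ᵥ x t + k₂ t * r t
  thetaLaw : ∀ t, stack k₁ k₂ (t + 1) = stack k₁ k₂ t -
    (sgn / normalizer Am bm (stack k₁ k₂) (stack x r) t ^ 2) •
      (Γ *ᵥ ∑ i, eps Am bm (stack k₁ k₂) (stack x r) ρ (x - xm) i t • zeta Am bm (stack x r) i t)
  rhoLaw : ∀ t, ρ (t + 1) = ρ t -
    γ * (∑ i, eps Am bm (stack k₁ k₂) (stack x r) ρ (x - xm) i t *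
      xi Am bm (stack k₁ k₂) (stack x r) i t) /
      normalizer Am bm (stack k₁ k₂) (stack x r) t ^ 2

end DirectAdaptive

end

/-!
The matching conditions turn the plant into the reference model driven by the parameter error:
with `θ*`, `ρ* = 1 / k₂*` and `φ = θ - θ*`, the tracking error satisfies
`e(t+1) = A_m e(t) + ρ* φᵀ(t) ω(t) b_m`. Hence each estimation error is linear in the parameter
errors, `εᵢ = ρ* φᵀ ζᵢ + (ρ - ρ*) ξᵢ + δᵢ`, where `δ` is a free, exponentially decaying response of
the reference dynamics (`exists_eps_eq`).

*Adaptation* (`lyapunov_step`, `adaptation`). The function `|ρ*| φᵀ Γ⁻¹ φ + (ρ - ρ*)² / γ` decreases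
at each step by a fixed multiple of `∑ᵢ εᵢ² / m²`, up to a multiple of `∑ᵢ δᵢ²`, which is summable.
The gain bounds make the quadratic term of the increment smaller than the linear one, by
Cauchy-Schwarz and the normalization. So `θ` and `ρ` are bounded, `ε / m → 0` and
`θ(t+1) - θ(t) → 0`; nothing about the size of `ω` is needed.

*Closing the loop* (`loop_bounded`). The swapping identity `xi_succ` reads
`ξ(t+1) = A_m ξ(t) + Z(t+1) (θ(t+1) - θ(t))`, where the rows of `Z` are the `ζᵢᵀ`, while
`Z(t+1) = A_m Z(t) + b_m ωᵀ(t)` and `‖ω‖ ≤ ‖ε - ρ ξ‖ + const`. In a norm that `A_m` strictly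
contracts (`SchurStable.exists_seminorm`), `Z` and `ξ` thus form two contractions in which the gain
from `ξ` to `Z` is bounded and the gain from `Z` back to `ξ` tends to zero
(`exists_bound_of_vanishing_feedback`). Both are therefore bounded, then `ξ → 0`, and
`e = ε - ρ ξ → 0`.
-/

noncomputable section

namespace DirectAdaptive

variable {n : ℕ}

/-! ### Scalar recursive inequalities -/

lemma exists_bound_of_eventually_le_mul_add {W : ℕ → ℝ} {μ C : ℝ} (hμ₀ : 0 ≤ μ) (hμ : μ < 1)
    (h : ∀ᶠ t in atTop, W (t + 1) ≤ μ * W t + C) : ∃ B, ∀ t, W t ≤ B := by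
  obtain ⟨T, hT⟩ := eventually_atTop.1 h
  have key : ∀ k, W (T + k) ≤ max (W T) (C / (1 - μ)) := by
    intro k
    induction k with
    | zero => exact le_max_left _ _
    | succ k ih =>
      have h1 := hT (T + k) (by omega)
      have h2 : C ≤ (1 - μ) * max (W T) (C / (1 - μ)) := by
        rw [← div_le_iff₀' (by linarith)]
        exact le_max_right _ _
      rw [← add_assoc]
      nlinarith [mul_le_mul_of_nonneg_left ih hμ₀]
  obtain ⟨B, hB⟩ := ((Finset.range T).image W).bddAbove
  refine ⟨max B (max (W T) (C / (1 - μ))), fun t => ?_⟩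
  rcases lt_or_ge t T with ht | ht
  · exact le_max_of_le_left (hB (by simpa using ⟨t, ht, rfl⟩))
  · obtain ⟨k, rfl⟩ := Nat.exists_eq_add_of_le ht
    exact le_max_of_le_right (key k)

lemma tendsto_zero_of_le_mul_add {q β : ℕ → ℝ} {lam : ℝ} (hlam₀ : 0 ≤ lam) (hlam : lam < 1)
    (hq : ∀ t, 0 ≤ q t) (hβ : Tendsto β atTop (𝓝 0))
    (h : ∀ t, q (t + 1) ≤ lam * q t + β t) : Tendsto q atTop (𝓝 0) := by
  refine (tendsto_order.2 ⟨fun a ha => Eventually.of_forall fun t => ha.trans_le (hq t),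
    fun a ha => ?_⟩)
  obtain ⟨T, hT⟩ := eventually_atTop.1
    (hβ.eventually_lt_const (show 0 < (1 - lam) * (a / 2) by
      have : 0 < 1 - lam := by linarith
      positivity))
  have key : ∀ k, q (T + k) ≤ lam ^ k * q T + a / 2 := by
    intro k
    induction k with
    | zero => simp; linarith
    | succ k ih =>
      have h1 := h (T + k)
      have h2 := hT (T + k) (by omega)
      have h3 := mul_le_mul_of_nonneg_left ih hlam₀
      rw [← add_assoc, pow_succ]
      nlinarith
  have hlim : Tendsto (fun k => lam ^ k * q T) atTop (𝓝 0) := by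
    simpa using (tendsto_pow_atTop_nhds_zero_of_lt_one hlam₀ hlam).mul_const (q T)
  obtain ⟨K, hK⟩ := eventually_atTop.1 (hlim.eventually_lt_const (half_pos ha))
  filter_upwards [eventually_ge_atTop (T + K)] with t ht
  obtain ⟨k, rfl⟩ := Nat.exists_eq_add_of_le ht
  have h1 := key (K + k)
  have h2 := hK (K + k) (by omega)
  rw [add_assoc]
  linarith

/-- A nonnegative storage sequence that, up to a summable supply `d`, decreases by `a` at each step
is bounded, and the total dissipation is finite. -/
lemma bounded_and_summable_of_dissipation {V a d : ℕ → ℝ} (hV : ∀ t, 0 ≤ V t) (ha : ∀ t, 0 ≤ a t)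
    (hd : ∀ t, 0 ≤ d t) (hds : Summable d) (h : ∀ t, V (t + 1) ≤ V t - a t + d t) :
    (∃ B, ∀ t, V t ≤ B) ∧ Summable a := by
  have key : ∀ t, V t + ∑ s ∈ Finset.range t, a s ≤ V 0 + ∑ s ∈ Finset.range t, d s := by
    intro t
    induction t with
    | zero => simp
    | succ t ih =>
      rw [Finset.sum_range_succ, Finset.sum_range_succ]
      linarith [h t]
  have hle : ∀ t, ∑ s ∈ Finset.range t, d s ≤ ∑' s, d s :=
    fun t => hds.sum_le_tsum _ fun s _ => hd s
  refine ⟨⟨V 0 + ∑' s, d s, fun t => ?_⟩,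
    summable_of_sum_range_le ha (c := V 0 + ∑' s, d s) fun t => ?_⟩
  · linarith [key t, hle t, Finset.sum_nonneg fun s (_ : s ∈ Finset.range t) => ha s]
  · linarith [key t, hle t, hV t]

/-- Two coupled contractions. The gain `C` from `q` to `P` need not be small, since the gain `β`
from `P` back to `q` vanishes asymptotically. -/
lemma exists_bound_of_vanishing_feedback {P q η β : ℕ → ℝ} {lam C : ℝ} (hlam₀ : 0 ≤ lam)
    (hlam : lam < 1) (hC : 0 ≤ C) (hP : ∀ t, 0 ≤ P t) (hq : ∀ t, 0 ≤ q t)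
    (hη : Tendsto η atTop (𝓝 0)) (hβ : Tendsto β atTop (𝓝 0))
    (hη₀ : ∀ t, 0 ≤ η t) (hβ₀ : ∀ t, 0 ≤ β t)
    (h1 : ∀ t, P (t + 1) ≤ lam * P t + η t * (P t + q t) + C * q t + C)
    (h2 : ∀ t, q (t + 1) ≤ lam * q t + β t * P (t + 1)) :
    ∃ B, ∀ t, P t ≤ B ∧ q t ≤ B := by
  -- `P + K q` contracts once `K` is large: the gain from `q` to `P` then costs at most
  -- `2 (1 + C) / K ≤ (1 - lam) / 2` of the contraction margin.
  set K := 4 * (1 + C) / (1 - lam) + 1 with hK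
  set μ := (1 + lam) / 2 with hμ
  have hl : 0 < 1 - lam := by linarith
  have hK1 : 1 ≤ K := by rw [hK]; linarith [show 0 ≤ 4 * (1 + C) / (1 - lam) by positivity]
  have hK2 : 4 * (1 + C) ≤ (1 - lam) * K := by
    have : (1 - lam) * (4 * (1 + C) / (1 - lam)) = 4 * (1 + C) := mul_div_cancel₀ _ hl.ne'
    rw [hK, mul_add (1 - lam), this]
    linarith
  have hlim : Tendsto (fun t => (1 + K * β t) * (lam + η t)) atTop (𝓝 lam) := by
    simpa using ((hβ.const_mul K).const_add 1).mul (hη.const_add lam)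
  have hlim' : Tendsto (fun t => K * β t) atTop (𝓝 0) := by simpa using hβ.const_mul K
  have hW : ∀ᶠ t in atTop, P (t + 1) + K * q (t + 1) ≤ μ * (P t + K * q t) + 2 * C := by
    filter_upwards [hlim.eventually_le_const (show lam < μ by rw [hμ]; linarith),
      hlim'.eventually_le_const one_pos, hη.eventually_le_const one_pos] with t ht ht' ht''
    have hKβ : 0 ≤ K * β t := mul_nonneg (by linarith) (hβ₀ t)
    calc P (t + 1) + K * q (t + 1)
        ≤ (1 + K * β t) * P (t + 1) + K * lam * q t := by
          nlinarith [mul_le_mul_of_nonneg_left (h2 t) (by linarith : 0 ≤ K)]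
      _ ≤ (1 + K * β t) * (lam * P t + η t * (P t + q t) + C * q t + C) + K * lam * q t := by
          gcongr
          exact h1 t
      _ = (1 + K * β t) * (lam + η t) * P t
            + (1 + K * β t) * ((η t + C) * q t + C) + K * lam * q t := by ring
      _ ≤ μ * P t + 2 * ((1 + C) * q t + C) + K * lam * q t := by
          have := hP t
          have := hq t
          have := hη₀ t
          gcongr
          linarith
      _ ≤ μ * (P t + K * q t) + 2 * C := by
          rw [hμ]
          nlinarith [mul_le_mul_of_nonneg_right hK2 (hq t)]
  obtain ⟨B, hB⟩ := exists_bound_of_eventually_le_mul_add (W := fun t => P t + K * q t)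
    (by rw [hμ]; linarith) (by rw [hμ]; linarith) hW
  refine ⟨B, fun t => ?_⟩
  have h3 := hB t
  have h4 := hP t
  have h5 := hq t
  have h6 : q t ≤ K * q t := le_mul_of_one_le_left h5 hK1
  constructor <;> linarith

/-! ### Contracting seminorm of a stable matrix -/

section OperatorNorm

attribute [local instance] Matrix.linftyOpNormedRing Matrix.linftyOpNormedAlgebra

/-- Gelfand's formula, applied to the complexification of `M`, makes the powers of `M` decay
geometrically. -/
lemma SchurStable.summable_norm_pow {M : Matrix (Fin n) (Fin n) ℝ} (hM : SchurStable M) :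
    Summable fun k : ℕ => ‖M ^ k‖ := by
  rcases Nat.eq_zero_or_pos n with rfl | hn
  · simp [Subsingleton.elim _ (0 : Matrix (Fin 0) (Fin 0) ℝ)]
  have : Nonempty (Fin n) := ⟨⟨0, hn⟩⟩
  have : CompleteSpace (Matrix (Fin n) (Fin n) ℂ) := FiniteDimensional.complete ℂ _
  set N := M.map (algebraMap ℝ ℂ)
  have hnorm : ∀ k : ℕ, ‖N ^ k‖ = ‖M ^ k‖ := by
    intro k
    rw [← Matrix.map_pow]
    simp [Matrix.linfty_opNorm_def]
  have hr : spectralRadius ℂ N < 1 := by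
    simpa using spectrum.spectralRadius_lt_of_forall_lt N (r := 1) fun z hz => hM z hz
  obtain ⟨c, hc, hc1⟩ := exists_between hr
  lift c to NNReal using (hc1.trans ENNReal.one_lt_top).ne
  have hc1' : (c : ℝ) < 1 := by exact_mod_cast hc1
  refine Summable.of_norm_bounded_eventually_nat (g := fun k => (c : ℝ) ^ k)
    (summable_geometric_of_lt_one c.2 hc1') ?_
  have hG := spectrum.pow_nnnorm_pow_one_div_tendsto_nhds_spectralRadius N
  filter_upwards [hG.eventually_lt_const hc, eventually_gt_atTop 0] with k hk hk0
  rw [norm_norm, ← hnorm]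
  have hk' : (‖N ^ k‖₊ : ENNReal) < (c : ENNReal) ^ k := by
    have := ENNReal.rpow_lt_rpow hk (show (0 : ℝ) < k by exact_mod_cast hk0)
    rwa [← ENNReal.rpow_mul, one_div, inv_mul_cancel₀ (by positivity), ENNReal.rpow_one,
      ENNReal.rpow_natCast] at this
  exact_mod_cast hk'.le

/-- Every stable matrix strictly contracts some norm, namely `p v = ∑ₖ ‖Mᵏ v‖`: shifting the series
gives `p (M v) = p v - ‖v‖`. -/
lemma SchurStable.exists_seminorm {M : Matrix (Fin n) (Fin n) ℝ} (hM : SchurStable M) :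
    ∃ (p : Seminorm ℝ (Fin n → ℝ)) (lam : ℝ), 0 ≤ lam ∧ lam < 1 ∧
      (∀ v, p (M *ᵥ v) ≤ lam * p v) ∧ ∀ v, ‖v‖ ≤ p v := by
  have hs := hM.summable_norm_pow
  set S := ∑' k : ℕ, ‖M ^ k‖ with hS
  have hle : ∀ (v : Fin n → ℝ) (k : ℕ), ‖M ^ k *ᵥ v‖ ≤ ‖M ^ k‖ * ‖v‖ :=
    fun v k => Matrix.linfty_opNorm_mulVec _ _
  have hsum : ∀ v : Fin n → ℝ, Summable fun k : ℕ => ‖M ^ k *ᵥ v‖ := fun v =>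
    Summable.of_nonneg_of_le (fun _ => norm_nonneg _) (hle v) (hs.mul_right _)
  let p : Seminorm ℝ (Fin n → ℝ) := Seminorm.of (fun v => ∑' k : ℕ, ‖M ^ k *ᵥ v‖)
    (fun v w => by
      rw [← (hsum v).tsum_add (hsum w)]
      refine (hsum _).tsum_le_tsum (fun k => ?_) ((hsum v).add (hsum w))
      rw [Matrix.mulVec_add]
      exact norm_add_le _ _)
    (fun a v => by
      simp only [Matrix.mulVec_smul, norm_smul]
      exact tsum_mul_left)
  have hp : ∀ v, p v = ∑' k : ℕ, ‖M ^ k *ᵥ v‖ := fun v => rfl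
  have hshift : ∀ v, p v = ‖v‖ + p (M *ᵥ v) := by
    intro v
    rw [hp, (hsum v).tsum_eq_zero_add, hp]
    simp [pow_succ]
  have hub : ∀ v, p v ≤ (S + 1) * ‖v‖ := by
    intro v
    have : p v ≤ S * ‖v‖ := by
      rw [hp, hS, ← tsum_mul_right]
      exact (hsum v).tsum_le_tsum (hle v) (hs.mul_right _)
    nlinarith [norm_nonneg v]
  have hS0 : 0 ≤ S := tsum_nonneg fun k => norm_nonneg _
  refine ⟨p, 1 - 1 / (S + 1), ?_, ?_, fun v => ?_, fun v => ?_⟩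
  · rw [sub_nonneg, div_le_one (by positivity)]
    linarith
  · have : 0 < 1 / (S + 1) := by positivity
    linarith
  · have h1 : 1 / (S + 1) * p v ≤ ‖v‖ := by
      rw [one_div_mul_eq_div, div_le_iff₀' (by positivity)]
      exact hub v
    linarith [hshift v]
  · linarith [hshift v, apply_nonneg p (M *ᵥ v)]

end OperatorNorm

/-! ### Quadratic forms -/

lemma exists_mul_dotProduct_le_of_posDef {ι : Type*} [Fintype ι] {M : Matrix ι ι ℝ}
    (hM : M.PosDef) : ∃ c > 0, ∀ v : ι → ℝ, c * (v ⬝ᵥ v) ≤ v ⬝ᵥ M *ᵥ v := by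
  classical
  rcases isEmpty_or_nonempty ι with hι | hι
  · exact ⟨1, one_pos, fun v => by simp [dotProduct]⟩
  have hc1 : ContinuousOn (fun v : ι → ℝ => (v ⬝ᵥ M *ᵥ v) / (v ⬝ᵥ v)) (Metric.sphere 0 1) := by
    refine ContinuousOn.div (by fun_prop) (by fun_prop) fun v hv => ?_
    have : v ≠ 0 := by rintro rfl; simp at hv
    simpa [dotProduct_self_eq_zero] using this
  have hne : (Metric.sphere (0 : ι → ℝ) 1).Nonempty := NormedSpace.sphere_nonempty.2 zero_le_one
  obtain ⟨w, hw, hmin⟩ := (isCompact_sphere (0 : ι → ℝ) 1).exists_isMinOn hne hc1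
  have hpos : ∀ v : ι → ℝ, v ≠ 0 → 0 < v ⬝ᵥ v := fun v hv => by
    simpa using Matrix.dotProduct_star_self_pos_iff (v := v) |>.2 hv
  have hw0 : w ≠ 0 := by rintro rfl; simp at hw
  refine ⟨(w ⬝ᵥ M *ᵥ w) / (w ⬝ᵥ w), div_pos ?_ (hpos w hw0), fun v => ?_⟩
  · simpa using hM.dotProduct_mulVec_pos hw0
  · rcases eq_or_ne v 0 with rfl | hv
    · simp
    rw [← le_div_iff₀ (hpos v hv)]
    have hv' : ‖v‖ ≠ 0 := norm_ne_zero_iff.2 hv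
    have := hmin (show ‖v‖⁻¹ • v ∈ Metric.sphere (0 : ι → ℝ) 1 by
      simp [norm_smul, hv'])
    refine this.trans_eq ?_
    simp only [Matrix.mulVec_smul, smul_dotProduct, dotProduct_smul, smul_eq_mul]
    rw [mul_div_mul_left _ _ (inv_ne_zero hv'), mul_div_mul_left _ _ (inv_ne_zero hv')]

/-- Cauchy-Schwarz in each coordinate. With the normalization, it bounds the second order terms of
the Lyapunov increment. -/
lemma sum_smul_dotProduct_self_add_sq_le {ι κ : Type*} [Fintype ι] [Fintype κ] (ε ξ : ι → ℝ)
    (ζ : ι → κ → ℝ) :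
    (∑ i, ε i • ζ i) ⬝ᵥ (∑ i, ε i • ζ i) + (∑ i, ε i * ξ i) ^ 2 ≤
      (∑ i, ε i ^ 2) * (∑ i, ζ i ⬝ᵥ ζ i + ∑ i, ξ i ^ 2) := by
  rw [mul_add]
  refine add_le_add ?_ (Finset.sum_mul_sq_le_sq_mul_sq _ _ _)
  simp only [dotProduct, Finset.sum_apply, Pi.smul_apply, smul_eq_mul, ← sq]
  rw [Finset.sum_comm (f := fun i j => ζ i j ^ 2), Finset.mul_sum]
  exact Finset.sum_le_sum fun j _ => Finset.sum_mul_sq_le_sq_mul_sq _ _ _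

lemma norm_sq_le_dotProduct_self {ι : Type*} [Fintype ι] (v : ι → ℝ) : ‖v‖ ^ 2 ≤ v ⬝ᵥ v := by
  have h0 : 0 ≤ v ⬝ᵥ v := Finset.sum_nonneg fun i _ => mul_self_nonneg (v i)
  refine (Real.le_sqrt (norm_nonneg v) h0).1 ?_
  refine (pi_norm_le_iff_of_nonneg (Real.sqrt_nonneg _)).2 fun i => Real.abs_le_sqrt ?_
  rw [sq]
  exact Finset.single_le_sum (f := fun i => v i * v i) (fun i _ => mul_self_nonneg (v i))
    (Finset.mem_univ i)

/-! ### The filters and the error model -/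

section Filters

variable {Am : Matrix (Fin n) (Fin n) ℝ} {bm : Fin n → ℝ}

lemma response_dotProduct (c : Fin (n + 1) → ℝ) (ω : ℕ → Fin (n + 1) → ℝ) (t : ℕ) (i : Fin n) :
    response Am bm (fun τ => c ⬝ᵥ ω τ) t i = c ⬝ᵥ zeta Am bm ω i t := by
  have h : ∀ t, response Am bm (fun τ => c ⬝ᵥ ω τ) t =
      ∑ j, c j • response Am bm (fun τ => ω τ j) t := by
    intro t
    induction t with
    | zero => simp [response]
    | succ t ih =>
      rw [response, ih]
      simp only [response, smul_add, Finset.sum_add_distrib, Matrix.mulVec_sum,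
        Matrix.mulVec_smul, dotProduct, Finset.sum_smul, smul_smul]
  rw [h]
  simp [dotProduct, zeta]

lemma response_sub (v w : ℕ → ℝ) (t : ℕ) :
    response Am bm (fun τ => v τ - w τ) t = response Am bm v t - response Am bm w t := by
  induction t with
  | zero => simp [response]
  | succ t ih =>
    simp only [response, ih, Matrix.mulVec_sub, sub_smul]
    abel

/-- Subtracting a constant vector from `θ` does not change `ξᵢ`, since on constant gains the filter
commutes with the gain. -/
lemma xi_sub_const (θ ω : ℕ → Fin (n + 1) → ℝ) (c : Fin (n + 1) → ℝ) (i : Fin n) (t : ℕ) :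
    xi Am bm θ ω i t =
      (θ t - c) ⬝ᵥ zeta Am bm ω i t - response Am bm (fun τ => (θ τ - c) ⬝ᵥ ω τ) t i := by
  simp only [sub_dotProduct, response_sub, Pi.sub_apply, response_dotProduct, xi]
  ring

/-- The swapping identity: `ξ` obeys the reference dynamics driven only by the increments
of the gains. -/
lemma xi_succ (θ ω : ℕ → Fin (n + 1) → ℝ) (t : ℕ) :
    (fun i => xi Am bm θ ω i (t + 1)) = Am *ᵥ (fun i => xi Am bm θ ω i t) +
      ∑ j, (θ (t + 1) - θ t) j • response Am bm (fun τ => ω τ j) (t + 1) := by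
  -- Freezing the gains at time `t`, the filtered product `θ(t)ᵀ ω` agrees with `θ(t)ᵀ ζᵢ`.
  have h : ∀ s, (fun i => θ t ⬝ᵥ zeta Am bm ω i s) = response Am bm (fun τ => θ t ⬝ᵥ ω τ) s :=
    fun s => funext fun i => (response_dotProduct _ _ _ _).symm
  have h1 : (fun i => xi Am bm θ ω i t) = response Am bm (fun τ => θ t ⬝ᵥ ω τ) t -
      response Am bm (fun τ => θ τ ⬝ᵥ ω τ) t := by
    rw [← h]
    rfl
  have h2 : (fun i => xi Am bm θ ω i (t + 1)) =
      (∑ j, (θ (t + 1) - θ t) j • response Am bm (fun τ => ω τ j) (t + 1)) +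
      (response Am bm (fun τ => θ t ⬝ᵥ ω τ) (t + 1) -
        response Am bm (fun τ => θ τ ⬝ᵥ ω τ) (t + 1)) := by
    rw [← h]
    ext i
    have : (∑ j, (θ (t + 1) - θ t) j • response Am bm (fun τ => ω τ j) (t + 1)) i =
        (θ (t + 1) - θ t) ⬝ᵥ zeta Am bm ω i (t + 1) := by
      simp [dotProduct, zeta]
    rw [Pi.add_apply, this]
    simp only [Pi.sub_apply, sub_dotProduct, xi]
    ring
  rw [h2, h1, add_comm]
  congr 1
  simp only [response, Matrix.mulVec_sub]
  abel

/-- The estimation error is linear in the parameter errors `θ - θ*` and `ρ - ρ*`, up to a free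
response `δ` of the reference dynamics. -/
lemma exists_eps_eq {θ ω : ℕ → Fin (n + 1) → ℝ} {e : ℕ → Fin n → ℝ} {θs : Fin (n + 1) → ℝ} {ρs : ℝ}
    (he : ∀ t, e (t + 1) = Am *ᵥ e t + (ρs * ((θ t - θs) ⬝ᵥ ω t)) • bm) :
    ∃ δ : ℕ → Fin n → ℝ, (∀ t, δ (t + 1) = Am *ᵥ δ t) ∧ ∀ (ρ : ℕ → ℝ) i t,
      eps Am bm θ ω ρ e i t =
        ρs * ((θ t - θs) ⬝ᵥ zeta Am bm ω i t) + (ρ t - ρs) * xi Am bm θ ω i t + δ t i := by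
  refine ⟨fun t => e t - ρs • response Am bm (fun τ => (θ τ - θs) ⬝ᵥ ω τ) t, fun t => ?_,
    fun ρ i t => ?_⟩
  · simp only [he, response, Matrix.mulVec_sub, Matrix.mulVec_smul, smul_add, smul_smul]
    abel
  · simp only [eps, Pi.sub_apply, Pi.smul_apply, smul_eq_mul, sub_mul]
    nth_rewrite 3 [xi_sub_const θ ω θs i t]
    ring

lemma normalizer_sq (θ ω : ℕ → Fin (n + 1) → ℝ) (t : ℕ) :
    normalizer Am bm θ ω t ^ 2 =
      1 + ∑ i, zeta Am bm ω i t ⬝ᵥ zeta Am bm ω i t + ∑ i, xi Am bm θ ω i t ^ 2 := by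
  refine Real.sq_sqrt ?_
  have h1 : 0 ≤ ∑ i, zeta Am bm ω i t ⬝ᵥ zeta Am bm ω i t :=
    Finset.sum_nonneg fun i _ => Finset.sum_nonneg fun j _ => mul_self_nonneg _
  have h2 : 0 ≤ ∑ i, xi Am bm θ ω i t ^ 2 := Finset.sum_nonneg fun i _ => sq_nonneg _
  linarith

lemma one_le_normalizer_sq (θ ω : ℕ → Fin (n + 1) → ℝ) (t : ℕ) :
    1 ≤ normalizer Am bm θ ω t ^ 2 := by
  have h1 : 0 ≤ ∑ i, zeta Am bm ω i t ⬝ᵥ zeta Am bm ω i t :=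
    Finset.sum_nonneg fun i _ => Finset.sum_nonneg fun j _ => mul_self_nonneg _
  have h2 : 0 ≤ ∑ i, xi Am bm θ ω i t ^ 2 := Finset.sum_nonneg fun i _ => sq_nonneg _
  rw [normalizer_sq]
  linarith

end Filters

/-! ### Lyapunov analysis of the adaptive laws -/

/-- One step of the normalized gradient law: the Lyapunov function
`|ρ*| φᵀ Γ⁻¹ φ + ψ² / γ` of the parameter errors `φ`, `ψ` dissipates the normalized squared
estimation error, up to the free response `δ`. -/
lemma lyapunov_step {ι κ : Type*} [Fintype ι] [Fintype κ] [DecidableEq κ] {Γ : Matrix κ κ ℝ}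
    (hΓ : Γ.PosDef) {γ α ρs s M : ℝ} (hγ : 0 < γ) (hα : 0 < α)
    (hΓα : ∀ v, |ρs| * (v ⬝ᵥ Γ *ᵥ v) ≤ (2 - α) * (v ⬝ᵥ v)) (hγα : γ ≤ 2 - α)
    (hs : |ρs| * s = ρs) (hs2 : s ^ 2 = 1) {ε ξ δ : ι → ℝ} {ζ : ι → κ → ℝ} {φ : κ → ℝ} {ψ : ℝ}
    (hε : ∀ i, ε i = ρs * (φ ⬝ᵥ ζ i) + ψ * ξ i + δ i)
    (hM : M = 1 + ∑ i, ζ i ⬝ᵥ ζ i + ∑ i, ξ i ^ 2) (hM1 : 1 ≤ M) :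
    |ρs| * ((φ - (s / M) • Γ *ᵥ ∑ i, ε i • ζ i) ⬝ᵥ
        Γ⁻¹ *ᵥ (φ - (s / M) • Γ *ᵥ ∑ i, ε i • ζ i)) +
      (ψ - γ * (∑ i, ε i * ξ i) / M) ^ 2 / γ ≤
    |ρs| * (φ ⬝ᵥ Γ⁻¹ *ᵥ φ) + ψ ^ 2 / γ - α / 2 * ((∑ i, ε i ^ 2) / M) +
      2 / α * ∑ i, δ i ^ 2 := by
  have hM0 : 0 < M := by linarith
  have hdet : IsUnit Γ.det := (Matrix.isUnit_iff_isUnit_det _).1 hΓ.isUnit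
  have hsymm : Γᵀ = Γ := hΓ.isHermitian
  set g := ∑ i, ε i • ζ i with hg
  set h := ∑ i, ε i * ξ i with hh
  set E := ∑ i, ε i ^ 2 with hE
  set D := ∑ i, δ i ^ 2 with hD
  set F := ∑ i, ε i * δ i with hF
  have hE0 : 0 ≤ E := Finset.sum_nonneg fun i _ => sq_nonneg _
  have hD0 : 0 ≤ D := Finset.sum_nonneg fun i _ => sq_nonneg _
  have hquad : (φ - (s / M) • Γ *ᵥ g) ⬝ᵥ Γ⁻¹ *ᵥ (φ - (s / M) • Γ *ᵥ g) =
      φ ⬝ᵥ Γ⁻¹ *ᵥ φ - 2 * (s / M) * (φ ⬝ᵥ g) + (s / M) ^ 2 * (g ⬝ᵥ Γ *ᵥ g) := by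
    have h1 : Γ⁻¹ *ᵥ (Γ *ᵥ g) = g := by
      rw [Matrix.mulVec_mulVec, Matrix.nonsing_inv_mul _ hdet, Matrix.one_mulVec]
    have h2 : (Γ *ᵥ g) ⬝ᵥ Γ⁻¹ *ᵥ φ = φ ⬝ᵥ g := by
      rw [Matrix.dotProduct_mulVec, ← Matrix.mulVec_transpose, Matrix.transpose_nonsing_inv, hsymm,
        h1, dotProduct_comm]
    simp only [Matrix.mulVec_sub, Matrix.mulVec_smul, h1, dotProduct_sub, sub_dotProduct,
      dotProduct_smul, smul_dotProduct, smul_eq_mul, h2, dotProduct_comm (Γ *ᵥ g) g]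
    ring
  have hcross : ρs * (φ ⬝ᵥ g) + ψ * h = E - F := by
    rw [hg, hh, hE, hF, dotProduct_sum, Finset.mul_sum, Finset.mul_sum, ← Finset.sum_add_distrib,
      ← Finset.sum_sub_distrib]
    refine Finset.sum_congr rfl fun i _ => ?_
    rw [dotProduct_smul, smul_eq_mul]
    linear_combination -ε i * hε i
  have hyoung : 2 * F ≤ α / 2 * E + 2 / α * D := by
    rw [hF, hE, hD, Finset.mul_sum, Finset.mul_sum, Finset.mul_sum, ← Finset.sum_add_distrib]
    refine Finset.sum_le_sum fun i _ => ?_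
    have : α / 2 * ε i ^ 2 + 2 / α * δ i ^ 2 - 2 * (ε i * δ i) =
        (α * ε i - 2 * δ i) ^ 2 / (2 * α) := by
      field_simp
      ring
    have : 0 ≤ (α * ε i - 2 * δ i) ^ 2 / (2 * α) := by positivity
    linarith
  have hcs : g ⬝ᵥ g + h ^ 2 ≤ E * M := by
    have := sum_smul_dotProduct_self_add_sq_le ε ξ ζ
    have hM' : ∑ i, ζ i ⬝ᵥ ζ i + ∑ i, ξ i ^ 2 = M - 1 := by rw [hM]; ring
    rw [hM'] at this
    linarith
  have h2α : 0 ≤ 2 - α := hγ.le.trans hγα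
  have hsecond : (|ρs| * (g ⬝ᵥ Γ *ᵥ g) + γ * h ^ 2) / M ^ 2 ≤ (2 - α) * (E / M) := by
    rw [div_le_iff₀ (by positivity)]
    calc |ρs| * (g ⬝ᵥ Γ *ᵥ g) + γ * h ^ 2 ≤ (2 - α) * (g ⬝ᵥ g) + (2 - α) * h ^ 2 := by
          gcongr ?_ + ?_ * h ^ 2
          exact hΓα g
      _ ≤ (2 - α) * (E * M) := by
          rw [← mul_add]
          gcongr
      _ = (2 - α) * (E / M) * M ^ 2 := by field_simp
  have hdist : 2 * F / M ≤ α / 2 * (E / M) + 2 / α * D := by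
    rw [div_le_iff₀ hM0]
    have : (α / 2 * (E / M) + 2 / α * D) * M = α / 2 * E + 2 / α * D * M := by field_simp
    rw [this]
    have : 2 / α * D ≤ 2 / α * D * M := le_mul_of_one_le_right (by positivity) hM1
    linarith
  have hexp : |ρs| * ((φ - (s / M) • Γ *ᵥ g) ⬝ᵥ Γ⁻¹ *ᵥ (φ - (s / M) • Γ *ᵥ g)) +
      (ψ - γ * h / M) ^ 2 / γ = |ρs| * (φ ⬝ᵥ Γ⁻¹ *ᵥ φ) + ψ ^ 2 / γ - 2 * (E / M) + 2 * F / M +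
      (|ρs| * (g ⬝ᵥ Γ *ᵥ g) + γ * h ^ 2) / M ^ 2 := by
    have hsq : (ψ - γ * h / M) ^ 2 / γ = ψ ^ 2 / γ - 2 * ψ * h / M + γ * h ^ 2 / M ^ 2 := by
      field_simp
      ring
    rw [hquad, hsq]
    linear_combination (-2 * (φ ⬝ᵥ g) / M) * hs + (|ρs| * (g ⬝ᵥ Γ *ᵥ g) / M ^ 2) * hs2 -
      2 / M * hcross
  rw [hexp]
  linarith

section Adaptation

variable {Am : Matrix (Fin n) (Fin n) ℝ} {bm : Fin n → ℝ}

/-- Square summability of a free response, so that it is an admissible supply in the Lyapunov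
inequality. -/
lemma SchurStable.summable_sum_sq (hAm : SchurStable Am) {δ : ℕ → Fin n → ℝ}
    (hδ : ∀ t, δ (t + 1) = Am *ᵥ δ t) : Summable fun t => ∑ i, δ t i ^ 2 := by
  obtain ⟨p, lam, hlam₀, hlam, hp, hpn⟩ := hAm.exists_seminorm
  have hdecay : ∀ t, p (δ t) ≤ lam ^ t * p (δ 0) := by
    intro t
    induction t with
    | zero => simp
    | succ t ih =>
      rw [hδ, pow_succ', mul_assoc]
      exact (hp _).trans (mul_le_mul_of_nonneg_left ih hlam₀)
  refine summable_sum fun i _ => ?_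
  refine Summable.of_nonneg_of_le (fun t => sq_nonneg _) (fun t => ?_)
    ((summable_geometric_of_lt_one (sq_nonneg lam)
      (pow_lt_one₀ hlam₀ hlam two_ne_zero)).mul_right (p (δ 0) ^ 2))
  calc δ t i ^ 2 = |δ t i| ^ 2 := (sq_abs _).symm
    _ ≤ (lam ^ t * p (δ 0)) ^ 2 := by
        gcongr
        exact (norm_le_pi_norm (δ t) i).trans ((hpn _).trans (hdecay t))
    _ = (lam ^ 2) ^ t * p (δ 0) ^ 2 := by ring

/-- The adaptive laws alone, whatever `ω` does, keep the parameters bounded, make the normalized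
estimation error vanish and slow down the adaptation. -/
lemma adaptation (hAm : SchurStable Am) {θ ω : ℕ → Fin (n + 1) → ℝ} {ρ : ℕ → ℝ}
    {e : ℕ → Fin n → ℝ} {θs : Fin (n + 1) → ℝ} {ρs s γ k : ℝ}
    {Γ : Matrix (Fin (n + 1)) (Fin (n + 1)) ℝ} (hρs : ρs ≠ 0) (hs : |ρs| * s = ρs)
    (hs2 : s ^ 2 = 1) (hk : |ρs| * k ≤ 1) (hΓ : Γ.PosDef)
    (hΓk : ((2 * k) • (1 : Matrix (Fin (n + 1)) (Fin (n + 1)) ℝ) - Γ).PosDef)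
    (hγ : 0 < γ) (hγ2 : γ < 2)
    (he : ∀ t, e (t + 1) = Am *ᵥ e t + (ρs * ((θ t - θs) ⬝ᵥ ω t)) • bm)
    (hθ : ∀ t, θ (t + 1) = θ t - (s / normalizer Am bm θ ω t ^ 2) •
      (Γ *ᵥ ∑ i, eps Am bm θ ω ρ e i t • zeta Am bm ω i t))
    (hρ : ∀ t, ρ (t + 1) = ρ t - γ * (∑ i, eps Am bm θ ω ρ e i t * xi Am bm θ ω i t) /
      normalizer Am bm θ ω t ^ 2) :
    BoundedSignal θ ∧ BoundedSignal ρ ∧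
      Tendsto (fun t => √((∑ i, eps Am bm θ ω ρ e i t ^ 2) / normalizer Am bm θ ω t ^ 2))
        atTop (𝓝 0) ∧
      Tendsto (fun t => ‖θ (t + 1) - θ t‖) atTop (𝓝 0) := by
  obtain ⟨δ, hδ, hε⟩ := exists_eps_eq he
  obtain ⟨c, hc, hcΓ⟩ := exists_mul_dotProduct_le_of_posDef hΓk
  obtain ⟨d, hd, hdΓ⟩ := exists_mul_dotProduct_le_of_posDef hΓ.inv
  have hρs0 : 0 < |ρs| := abs_pos.2 hρs
  -- `|ρ*| Γ ≤ (2 - |ρ*| c) I` because `|ρ*| k ≤ 1`, so `α` is the common margin of both gains.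
  set α := min (|ρs| * c) (2 - γ) with hαdef
  have hα : 0 < α := lt_min (by positivity) (by linarith)
  have hΓα : ∀ v, |ρs| * (v ⬝ᵥ Γ *ᵥ v) ≤ (2 - α) * (v ⬝ᵥ v) := by
    intro v
    have h1 := hcΓ v
    rw [Matrix.sub_mulVec, Matrix.smul_mulVec, Matrix.one_mulVec, dotProduct_sub, dotProduct_smul,
      smul_eq_mul] at h1
    have hvv : 0 ≤ v ⬝ᵥ v := Finset.sum_nonneg fun i _ => mul_self_nonneg (v i)
    have h2 : α ≤ |ρs| * c := min_le_left _ _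
    calc |ρs| * (v ⬝ᵥ Γ *ᵥ v) ≤ |ρs| * ((2 * k - c) * (v ⬝ᵥ v)) := by
          gcongr
          linarith
      _ = (2 * (|ρs| * k) - |ρs| * c) * (v ⬝ᵥ v) := by ring
      _ ≤ (2 - α) * (v ⬝ᵥ v) := by
          gcongr
          linarith
  have hγα : γ ≤ 2 - α := by linarith [min_le_right (|ρs| * c) (2 - γ)]
  set N : ℕ → ℝ := fun t => normalizer Am bm θ ω t ^ 2 with hN
  have hN1 : ∀ t, 1 ≤ N t := fun t => one_le_normalizer_sq _ _ t
  set E : ℕ → ℝ := fun t => ∑ i, eps Am bm θ ω ρ e i t ^ 2 with hE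
  have hE0 : ∀ t, 0 ≤ E t := fun t => Finset.sum_nonneg fun i _ => sq_nonneg _
  have hEN : ∀ t, 0 ≤ E t / N t := fun t => div_nonneg (hE0 t) (by linarith [hN1 t])
  set V : ℕ → ℝ := fun t => |ρs| * ((θ t - θs) ⬝ᵥ Γ⁻¹ *ᵥ (θ t - θs)) + (ρ t - ρs) ^ 2 / γ with hV
  have hquad : ∀ t, d * ‖θ t - θs‖ ^ 2 ≤ (θ t - θs) ⬝ᵥ Γ⁻¹ *ᵥ (θ t - θs) := fun t =>
    (mul_le_mul_of_nonneg_left (norm_sq_le_dotProduct_self _) hd.le).trans (hdΓ _)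
  have hquad0 : ∀ t, 0 ≤ (θ t - θs) ⬝ᵥ Γ⁻¹ *ᵥ (θ t - θs) := fun t =>
    le_trans (by positivity) (hquad t)
  have hV0 : ∀ t, 0 ≤ V t := fun t => by
    have := hquad0 t
    positivity
  have hstep : ∀ t, V (t + 1) ≤ V t - α / 2 * (E t / N t) + 2 / α * ∑ i, δ t i ^ 2 := by
    intro t
    have := lyapunov_step hΓ hγ hα hΓα hγα hs hs2 (fun i => hε ρ i t)
      (normalizer_sq θ ω t) (one_le_normalizer_sq θ ω t)
    rwa [sub_right_comm (θ t), ← hθ, sub_right_comm (ρ t), ← hρ] at this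
  obtain ⟨⟨B, hB⟩, hsum⟩ := bounded_and_summable_of_dissipation hV0
    (fun t => mul_nonneg (by positivity) (hEN t)) (fun t => by positivity)
    ((hAm.summable_sum_sq hδ).mul_left (2 / α)) hstep
  have hlim : Tendsto (fun t => √(E t / N t)) atTop (𝓝 0) := by
    have h1 := ((summable_mul_left_iff (by positivity : α / 2 ≠ 0)).1 hsum).tendsto_atTop_zero
    simpa using h1.sqrt
  refine ⟨⟨√(B / (|ρs| * d)) + ‖θs‖, fun t => ?_⟩, ⟨√(γ * B) + |ρs|, fun t => ?_⟩, hlim, ?_⟩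
  · have h1 : ‖θ t - θs‖ ≤ √(B / (|ρs| * d)) := by
      refine Real.le_sqrt_of_sq_le ?_
      rw [le_div_iff₀ (by positivity)]
      have h2 : 0 ≤ (ρ t - ρs) ^ 2 / γ := by positivity
      have h3 := mul_le_mul_of_nonneg_left (hquad t) hρs0.le
      have h4 := hB t
      simp only [hV] at h4
      linarith
    have := norm_add_le (θ t - θs) θs
    rw [sub_add_cancel] at this
    linarith
  · have h1 : |ρ t - ρs| ≤ √(γ * B) := by
      refine Real.abs_le_sqrt ?_
      rw [← div_le_iff₀' hγ]
      have h3 := mul_nonneg hρs0.le (hquad0 t)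
      have h4 := hB t
      simp only [hV] at h4
      linarith
    have := abs_add_le (ρ t - ρs) ρs
    rw [sub_add_cancel] at this
    rw [Real.norm_eq_abs]
    linarith
  · obtain ⟨C, hC0, hC⟩ : ∃ C, 0 ≤ C ∧ ∀ v : Fin (n + 1) → ℝ, ‖Γ *ᵥ v‖ ≤ C * ‖v‖ :=
      ⟨_, norm_nonneg _, fun v => (Matrix.toLin' Γ).toContinuousLinearMap.le_opNorm v⟩
    have hs1 : |s| = 1 := by
      simpa using (sq_eq_sq_iff_abs_eq_abs s 1).1 (by simpa using hs2)
    refine squeeze_zero (fun t => norm_nonneg _) (fun t => ?_)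
      (by simpa using hlim.const_mul C : Tendsto (fun t => C * √(E t / N t)) atTop (𝓝 0))
    have hNt : 0 < N t := by linarith [hN1 t]
    set g := ∑ i, eps Am bm θ ω ρ e i t • zeta Am bm ω i t with hg
    have hgle : ‖g‖ ≤ √(E t * N t) := by
      refine Real.le_sqrt_of_sq_le ?_
      have h1 := sum_smul_dotProduct_self_add_sq_le (fun i => eps Am bm θ ω ρ e i t)
        (fun i => xi Am bm θ ω i t) (fun i => zeta Am bm ω i t)
      have h2 : N t = 1 + ∑ i, zeta Am bm ω i t ⬝ᵥ zeta Am bm ω i t +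
        ∑ i, xi Am bm θ ω i t ^ 2 := normalizer_sq θ ω t
      have h3 : 0 ≤ (∑ i, eps Am bm θ ω ρ e i t * xi Am bm θ ω i t) ^ 2 := sq_nonneg _
      have h4 := norm_sq_le_dotProduct_self g
      have h5 := hE0 t
      rw [h2]
      linarith
    have hdiff : θ (t + 1) - θ t = -((s / N t) • (Γ *ᵥ g)) := by
      rw [hθ, sub_sub_cancel_left]
    have hsqrt : √(E t * N t) / N t = √(E t / N t) := by
      have h1 : E t * N t = E t / N t * N t ^ 2 := by field_simp
      rw [h1, Real.sqrt_mul (hEN t), Real.sqrt_sq hNt.le, mul_div_assoc, div_self hNt.ne', mul_one]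
    rw [hdiff, norm_neg, norm_smul, norm_div, Real.norm_eq_abs, hs1, Real.norm_of_nonneg hNt.le]
    calc 1 / N t * ‖Γ *ᵥ g‖ ≤ 1 / N t * (C * √(E t * N t)) := by
          gcongr
          exact (hC g).trans (mul_le_mul_of_nonneg_left hgle hC0)
      _ = C * (√(E t * N t) / N t) := by ring
      _ = C * √(E t / N t) := by rw [hsqrt]

end Adaptation

/-! ### Boundedness of the loop and convergence of the tracking error -/

section Loop

variable {Am : Matrix (Fin n) (Fin n) ℝ} {bm : Fin n → ℝ}

lemma sum_dotProduct_zeta_le {p : Seminorm ℝ (Fin n → ℝ)} (hp : ∀ v, ‖v‖ ≤ p v)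
    (ω : ℕ → Fin (n + 1) → ℝ) (t : ℕ) :
    ∑ i, zeta Am bm ω i t ⬝ᵥ zeta Am bm ω i t ≤
      n * (∑ j, p (response Am bm (fun τ => ω τ j) t)) ^ 2 := by
  have h : ∀ i, zeta Am bm ω i t ⬝ᵥ zeta Am bm ω i t ≤
      (∑ j, p (response Am bm (fun τ => ω τ j) t)) ^ 2 := by
    intro i
    calc zeta Am bm ω i t ⬝ᵥ zeta Am bm ω i t
        ≤ ∑ j, p (response Am bm (fun τ => ω τ j) t) ^ 2 := by
          refine Finset.sum_le_sum fun j _ => ?_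
          rw [← sq, ← sq_abs]
          exact pow_le_pow_left₀ (abs_nonneg _)
            ((norm_le_pi_norm (response Am bm (fun τ => ω τ j) t) i).trans (hp _)) 2
      _ ≤ _ := Finset.sum_sq_le_sq_sum_of_nonneg fun j _ => apply_nonneg p _
  simpa using Finset.sum_le_sum fun i (_ : i ∈ Finset.univ) => h i

lemma normalizer_le {p : Seminorm ℝ (Fin n → ℝ)} (hp : ∀ v, ‖v‖ ≤ p v)
    (θ ω : ℕ → Fin (n + 1) → ℝ) (t : ℕ) :
    normalizer Am bm θ ω t ≤ 1 + (n + 1) * (∑ j, p (response Am bm (fun τ => ω τ j) t)) +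
      (n + 1) * p (fun i => xi Am bm θ ω i t) := by
  set P := ∑ j, p (response Am bm (fun τ => ω τ j) t)
  set q := p (fun i => xi Am bm θ ω i t)
  have hP : 0 ≤ P := Finset.sum_nonneg fun j _ => apply_nonneg p _
  have hq : 0 ≤ q := apply_nonneg p _
  have h1 : ∑ i, zeta Am bm ω i t ⬝ᵥ zeta Am bm ω i t ≤ n * P ^ 2 := sum_dotProduct_zeta_le hp ω t
  have h2 : ∑ i, xi Am bm θ ω i t ^ 2 ≤ n * q ^ 2 := by
    have : ∀ i ∈ Finset.univ, xi Am bm θ ω i t ^ 2 ≤ q ^ 2 := by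
      intro i _
      rw [← sq_abs]
      exact pow_le_pow_left₀ (abs_nonneg _)
        ((norm_le_pi_norm (fun i => xi Am bm θ ω i t) i).trans (hp _)) 2
    simpa using Finset.sum_le_sum this
  refine Real.sqrt_le_iff.2 ⟨by positivity, ?_⟩
  have hn : (0 : ℝ) ≤ n := n.cast_nonneg
  have h3 : (1 + (n + 1) * P + (n + 1) * q) ^ 2 = 1 + n * P ^ 2 + n * q ^ 2 +
      ((n ^ 2 + n + 1) * P ^ 2 + (n ^ 2 + n + 1) * q ^ 2 + 2 * (n + 1) * P + 2 * (n + 1) * q +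
        2 * (n + 1) ^ 2 * (P * q)) := by ring
  rw [h3]
  have : 0 ≤ (n ^ 2 + n + 1) * P ^ 2 + (n ^ 2 + n + 1) * q ^ 2 + 2 * (n + 1) * P +
    2 * (n + 1) * q + 2 * (n + 1) ^ 2 * (P * q) := by positivity
  linarith

/-- Closing the loop. The regressor grows at most like the tracking error, the tracking error is
`ε - ρ ξ`, and `ξ` is fed by the regressor only through the vanishing increments of the gains. -/
lemma loop_bounded (hAm : SchurStable Am) {θ ω : ℕ → Fin (n + 1) → ℝ} {ρ : ℕ → ℝ}
    {e : ℕ → Fin n → ℝ} (hρ : BoundedSignal ρ)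
    (hratio : Tendsto (fun t => √((∑ i, eps Am bm θ ω ρ e i t ^ 2) / normalizer Am bm θ ω t ^ 2))
      atTop (𝓝 0))
    (hθ : Tendsto (fun t => ‖θ (t + 1) - θ t‖) atTop (𝓝 0))
    {C : ℝ} (hω : ∀ t, ‖ω t‖ ≤ ‖e t‖ + C) :
    (∃ B, ∀ j t, ‖response Am bm (fun τ => ω τ j) t‖ ≤ B) ∧
      BoundedSignal (fun t i => xi Am bm θ ω i t) ∧
      BoundedSignal (normalizer Am bm θ ω) ∧ Tendsto e atTop (𝓝 0) := by
  obtain ⟨p, lam, hlam₀, hlam, hp, hpn⟩ := hAm.exists_seminorm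
  obtain ⟨R, hR⟩ := hρ
  have hR0 : 0 ≤ R := (norm_nonneg _).trans (hR 0)
  set P : ℕ → ℝ := fun t => ∑ j, p (response Am bm (fun τ => ω τ j) t) with hPdef
  set q : ℕ → ℝ := fun t => p (fun i => xi Am bm θ ω i t) with hqdef
  set η : ℕ → ℝ := fun t =>
    √((∑ i, eps Am bm θ ω ρ e i t ^ 2) / normalizer Am bm θ ω t ^ 2) with hηdef
  have hP0 : ∀ t, 0 ≤ P t := fun t => Finset.sum_nonneg fun j _ => apply_nonneg p _
  have hq0 : ∀ t, 0 ≤ q t := fun t => apply_nonneg p _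
  have hη0 : ∀ t, 0 ≤ η t := fun t => Real.sqrt_nonneg _
  have hxi : ∀ t i, |xi Am bm θ ω i t| ≤ q t := fun t i =>
    (norm_le_pi_norm (fun i => xi Am bm θ ω i t) i).trans (hpn _)
  have heps : ∀ t i, |eps Am bm θ ω ρ e i t| ≤ η t * (1 + (n + 1) * P t + (n + 1) * q t) := by
    intro t i
    have hm : 0 < normalizer Am bm θ ω t ^ 2 := one_pos.trans_le (one_le_normalizer_sq θ ω t)
    have hm' : 0 ≤ normalizer Am bm θ ω t := Real.sqrt_nonneg _
    refine le_trans ?_ (mul_le_mul_of_nonneg_left (normalizer_le hpn θ ω t) (hη0 t))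
    have h1 : η t * normalizer Am bm θ ω t = √(∑ i, eps Am bm θ ω ρ e i t ^ 2) := by
      rw [hηdef]
      dsimp only
      rw [Real.sqrt_div' _ hm.le, Real.sqrt_sq hm', div_mul_cancel₀]
      rintro h
      simp [h] at hm
    rw [h1]
    exact Real.abs_le_sqrt (Finset.single_le_sum (f := fun i => eps Am bm θ ω ρ e i t ^ 2)
      (fun i _ => sq_nonneg _) (Finset.mem_univ i))
  have he : ∀ t, ‖e t‖ ≤ η t * (1 + (n + 1) * P t + (n + 1) * q t) + R * q t := by
    intro t
    have h1 := hP0 t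
    have h2 := hq0 t
    have h3 := hη0 t
    refine (pi_norm_le_iff_of_nonneg (by positivity)).2 fun i => ?_
    have h4 : e t i = eps Am bm θ ω ρ e i t - ρ t * xi Am bm θ ω i t := by
      rw [eps]
      ring
    rw [h4]
    refine (norm_sub_le _ _).trans (add_le_add (heps t i) ?_)
    rw [norm_mul]
    exact mul_le_mul (hR t) (hxi t i) (norm_nonneg _) hR0
  obtain ⟨H, hH⟩ := hratio.bddAbove_range
  have hH' : ∀ t, η t ≤ H := fun t => hH ⟨t, rfl⟩
  have hH0 : 0 ≤ H := (hη0 0).trans (hH' 0)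
  set L := (n + 1) * p bm with hL
  have hL0 : 0 ≤ L := mul_nonneg (by positivity) (apply_nonneg p _)
  have hPstep : ∀ t, P (t + 1) ≤ lam * P t + (L * (n + 1) * η t) * (P t + q t) +
      (L * (R + H + |C|)) * q t + L * (R + H + |C|) := by
    intro t
    have h1 : P (t + 1) ≤ lam * P t + L * ‖ω t‖ := by
      calc P (t + 1) ≤ ∑ j, (lam * p (response Am bm (fun τ => ω τ j) t) + ‖ω t‖ * p bm) := by
            refine Finset.sum_le_sum fun j _ => ?_
            refine (map_add_le_add p _ _).trans (add_le_add (hp _) ?_)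
            rw [map_smul_eq_mul]
            exact mul_le_mul_of_nonneg_right (norm_le_pi_norm _ j) (apply_nonneg p _)
        _ = lam * P t + L * ‖ω t‖ := by
            rw [Finset.sum_add_distrib, ← Finset.mul_sum]
            simp [hL]
            ring
    have h2 : ‖ω t‖ ≤ η t * (1 + (n + 1) * P t + (n + 1) * q t) + R * q t + |C| := by
      linarith [hω t, he t, le_abs_self C]
    have h3 : L * ‖ω t‖ ≤ L * ((n + 1) * η t * (P t + q t) + (R + H + |C|) * q t +
        (R + H + |C|)) := by
      refine mul_le_mul_of_nonneg_left (h2.trans ?_) hL0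
      have := hH' t
      have := mul_nonneg (add_nonneg hH0 (abs_nonneg C)) (hq0 t)
      linarith
    linarith
  have hqstep : ∀ t, q (t + 1) ≤ lam * q t + ‖θ (t + 1) - θ t‖ * P (t + 1) := by
    intro t
    change p (fun i => xi Am bm θ ω i (t + 1)) ≤ _
    rw [xi_succ]
    refine (map_add_le_add p _ _).trans (add_le_add (hp _) ?_)
    refine (Finset.le_sum_of_subadditive p (map_zero p).le (map_add_le_add p) _ _).trans ?_
    rw [hPdef, Finset.mul_sum]
    refine Finset.sum_le_sum fun j _ => ?_
    rw [map_smul_eq_mul]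
    exact mul_le_mul_of_nonneg_right (norm_le_pi_norm (θ (t + 1) - θ t) j) (apply_nonneg p _)
  obtain ⟨B, hB⟩ := exists_bound_of_vanishing_feedback hlam₀ hlam (by positivity) hP0 hq0
    (by simpa using hratio.const_mul (L * (n + 1))) hθ
    (fun t => mul_nonneg (by positivity) (hη0 t)) (fun t => norm_nonneg _) hPstep hqstep
  have hq : Tendsto q atTop (𝓝 0) := by
    refine tendsto_zero_of_le_mul_add hlam₀ hlam hq0
      (by simpa using hθ.mul_const B : Tendsto (fun t => ‖θ (t + 1) - θ t‖ * B) atTop (𝓝 0))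
      fun t => (hqstep t).trans ?_
    gcongr
    exact (hB _).1
  refine ⟨⟨B, fun j t => ?_⟩, ⟨B, fun t => (hpn _).trans (hB t).2⟩,
    ⟨1 + (n + 1) * B + (n + 1) * B, fun t => ?_⟩, ?_⟩
  · refine (hpn _).trans (le_trans ?_ (hB t).1)
    exact Finset.single_le_sum (f := fun j => p (response Am bm (fun τ => ω τ j) t))
      (fun j _ => apply_nonneg p _) (Finset.mem_univ j)
  · rw [Real.norm_of_nonneg (show 0 ≤ normalizer Am bm θ ω t from Real.sqrt_nonneg _)]
    refine (normalizer_le hpn θ ω t).trans ?_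
    gcongr
    · exact (hB t).1
    · exact (hB t).2
  · refine squeeze_zero_norm (a := fun t => η t * (1 + (n + 1) * B + (n + 1) * B) + R * q t)
      (fun t => (he t).trans ?_) ?_
    · have := hη0 t
      gcongr
      · exact (hB t).1
      · exact (hB t).2
    · simpa using (hratio.mul_const (1 + (n + 1) * B + (n + 1) * B)).add (hq.const_mul R)

lemma SchurStable.boundedSignal (hAm : SchurStable Am) {v : ℕ → ℝ} (hv : BoundedSignal v)
    {s : ℕ → Fin n → ℝ} (hs : ∀ t, s (t + 1) = Am *ᵥ s t + v t • bm) : BoundedSignal s := by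
  obtain ⟨p, lam, hlam₀, hlam, hp, hpn⟩ := hAm.exists_seminorm
  obtain ⟨C, hC⟩ := hv
  obtain ⟨B, hB⟩ := exists_bound_of_eventually_le_mul_add (W := fun t => p (s t)) (C := C * p bm)
    hlam₀ hlam (Eventually.of_forall fun t => by
      rw [hs]
      refine (map_add_le_add p _ _).trans (add_le_add (hp _) ?_)
      rw [map_smul_eq_mul]
      exact mul_le_mul_of_nonneg_right (hC t) (apply_nonneg p _))
  exact ⟨B, fun t => (hpn _).trans (hB t)⟩

end Loop

/-! ### Stacked and bounded signals -/

section Stack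

lemma norm_le_norm_stack (v : ℕ → Fin n → ℝ) (s : ℕ → ℝ) (t : ℕ) :
    ‖v t‖ ≤ ‖stack v s t‖ ∧ ‖s t‖ ≤ ‖stack v s t‖ := by
  refine ⟨(pi_norm_le_iff_of_nonneg (norm_nonneg _)).2 fun i => ?_, ?_⟩
  · simpa [stack] using norm_le_pi_norm (stack v s t) i.castSucc
  · simpa [stack] using norm_le_pi_norm (stack v s t) (Fin.last n)

lemma norm_stack_le (v : ℕ → Fin n → ℝ) (s : ℕ → ℝ) (t : ℕ) :
    ‖stack v s t‖ ≤ ‖v t‖ + ‖s t‖ := by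
  refine (pi_norm_le_iff_of_nonneg (by positivity)).2 fun i => ?_
  refine Fin.lastCases ?_ (fun i => ?_) i
  · simp [stack]
  · simpa [stack] using (norm_le_pi_norm (v t) i).trans (le_add_of_nonneg_right (norm_nonneg (s t)))

lemma stack_dotProduct_stack (v w : ℕ → Fin n → ℝ) (a c : ℕ → ℝ) (s t : ℕ) :
    stack v a s ⬝ᵥ stack w c t = v s ⬝ᵥ w t + a s * c t := by
  simp [stack, dotProduct, Fin.sum_univ_castSucc]

end Stack

lemma BoundedSignal.dotProduct {ι : Type*} [Fintype ι] {v w : ℕ → ι → ℝ} (hv : BoundedSignal v)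
    (hw : BoundedSignal w) : BoundedSignal fun t => v t ⬝ᵥ w t := by
  obtain ⟨B, hB⟩ := hv
  obtain ⟨C, hC⟩ := hw
  refine ⟨∑ _i : ι, B * C, fun t => norm_sum_le_of_le _ fun i _ => ?_⟩
  rw [norm_mul]
  exact mul_le_mul ((norm_le_pi_norm _ i).trans (hB t)) ((norm_le_pi_norm _ i).trans (hC t))
    (norm_nonneg _) ((norm_nonneg _).trans (hB t))

end DirectAdaptive

end

theorem theorem3p1 {n : ℕ}
    (A Am : Matrix (Fin n) (Fin n) ℝ) (b bm : Fin n → ℝ)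
    (hAm : DirectAdaptive.SchurStable Am)
    (k₁star : Fin n → ℝ) (k₂star : ℝ) (hk₂ : k₂star ≠ 0)
    (hA : A + Matrix.vecMulVec b k₁star = Am) (hb : k₂star • b = bm)
    (k₂a : ℝ) (hk₂a : 0 < k₂a) (hk₂a_le : k₂a ≤ |k₂star|)
    (Γ : Matrix (Fin (n + 1)) (Fin (n + 1)) ℝ) (hΓ : Γ.PosDef)
    (hΓ_lt : ((2 * k₂a) • (1 : Matrix (Fin (n + 1)) (Fin (n + 1)) ℝ) - Γ).PosDef)
    (γ : ℝ) (hγ : 0 < γ) (hγ_lt : γ < 2)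
    (r : ℕ → ℝ) (hr : DirectAdaptive.BoundedSignal r)
    (x xm : ℕ → Fin n → ℝ) (u : ℕ → ℝ) (k₁ : ℕ → Fin n → ℝ) (k₂ ρ : ℕ → ℝ)
    (hcl : DirectAdaptive.ClosedLoop A Am b bm Γ γ (Real.sign k₂star) r x xm u k₁ k₂ ρ) :
    (DirectAdaptive.BoundedSignal x ∧
      DirectAdaptive.BoundedSignal xm ∧
      DirectAdaptive.BoundedSignal u ∧
      DirectAdaptive.BoundedSignal k₁ ∧
      DirectAdaptive.BoundedSignal k₂ ∧
      DirectAdaptive.BoundedSignal ρ ∧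
      (∀ i, DirectAdaptive.BoundedSignal
        (DirectAdaptive.zeta Am bm (DirectAdaptive.stack x r) i)) ∧
      DirectAdaptive.BoundedSignal (DirectAdaptive.response Am bm
        (fun t => DirectAdaptive.stack k₁ k₂ t ⬝ᵥ DirectAdaptive.stack x r t)) ∧
      (∀ i, DirectAdaptive.BoundedSignal
        (DirectAdaptive.xi Am bm (DirectAdaptive.stack k₁ k₂) (DirectAdaptive.stack x r) i)) ∧
      (∀ i, DirectAdaptive.BoundedSignal
        (DirectAdaptive.eps Am bm (DirectAdaptive.stack k₁ k₂) (DirectAdaptive.stack x r) ρ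
          (x - xm) i)) ∧
      DirectAdaptive.BoundedSignal
        (DirectAdaptive.normalizer Am bm (DirectAdaptive.stack k₁ k₂)
          (DirectAdaptive.stack x r))) ∧
    Tendsto (fun t => x t - xm t) atTop (𝓝 0) := by
  open DirectAdaptive in
  -- The matching gains enter as constant signals, so that `stack` applies to them as well.
  set θs : Fin (n + 1) → ℝ := stack (fun _ => k₁star) (fun _ => k₂star) 0 with hθs
  set θ := stack k₁ k₂ with hθ
  set ω := stack x r with hω
  have hs : |k₂star⁻¹| * Real.sign k₂star = k₂star⁻¹ := by
    rcases hk₂.lt_or_gt with h | h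
    · rw [Real.sign_of_neg h, abs_of_neg (inv_lt_zero.2 h)]
      ring
    · rw [Real.sign_of_pos h, abs_of_pos (inv_pos.2 h), mul_one]
  have hs2 : Real.sign k₂star ^ 2 = 1 := by
    rcases hk₂.lt_or_gt with h | h
    · simp [Real.sign_of_neg h]
    · simp [Real.sign_of_pos h]
  have hk : |k₂star⁻¹| * k₂a ≤ 1 := by
    rw [abs_inv, inv_mul_le_iff₀ (abs_pos.2 hk₂), mul_one]
    exact hk₂a_le
  have he : ∀ t, (x - xm) (t + 1) =
      Am *ᵥ (x - xm) t + (k₂star⁻¹ * ((θ t - θs) ⬝ᵥ ω t)) • bm := by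
    intro t
    have h1 : (θ t - θs) ⬝ᵥ ω t = u t - k₁star ⬝ᵥ x t - k₂star * r t := by
      rw [sub_dotProduct, hθs, hθ, hω, stack_dotProduct_stack, stack_dotProduct_stack, hcl.control]
      ring
    have h2 : A *ᵥ x t = Am *ᵥ x t - (k₁star ⬝ᵥ x t) • b := by
      rw [← hA, Matrix.add_mulVec, Matrix.vecMulVec_mulVec]
      simp
    simp only [Pi.sub_apply, hcl.plant, hcl.model, h1, h2, ← hb, Matrix.mulVec_sub, smul_smul]
    have h3 : k₂star⁻¹ * (u t - k₁star ⬝ᵥ x t - k₂star * r t) * k₂star =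
        u t - k₁star ⬝ᵥ x t - r t * k₂star := by
      field_simp
    rw [h3]
    module
  obtain ⟨hθb, hρb, hratio, hdθ⟩ := adaptation hAm (inv_ne_zero hk₂) hs hs2 hk hΓ hΓ_lt hγ hγ_lt he
    hcl.thetaLaw hcl.rhoLaw
  have hxm : BoundedSignal xm := hAm.boundedSignal hr hcl.model
  obtain ⟨Cm, hCm⟩ := hxm
  obtain ⟨Cr, hCr⟩ := hr
  obtain ⟨⟨B, hB⟩, ⟨Bξ, hξ⟩, hm, hlim⟩ := loop_bounded hAm hρb hratio hdθ (ω := ω) (C := Cm + Cr)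
    fun t => by
      have h1 := norm_stack_le x r t
      have h2 := norm_sub_norm_le (x t) (xm t)
      rw [Pi.sub_apply]
      linarith [hCm t, hCr t]
  obtain ⟨Ce, hCe⟩ := hlim.norm.bddAbove_range
  have hCe' : ∀ t, ‖x t - xm t‖ ≤ Ce := fun t => hCe ⟨t, rfl⟩
  have hx : BoundedSignal x := ⟨Ce + Cm, fun t => by
    linarith [hCe' t, hCm t, norm_sub_norm_le (x t) (xm t)]⟩
  have hωb : BoundedSignal ω := by
    obtain ⟨Cx, hCx⟩ := hx
    exact ⟨Cx + Cr, fun t => (norm_stack_le x r t).trans (add_le_add (hCx t) (hCr t))⟩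
  have hu : BoundedSignal fun t => θ t ⬝ᵥ ω t := hθb.dotProduct hωb
  have hξi : ∀ i t, ‖xi Am bm θ ω i t‖ ≤ Bξ := fun i t =>
    (norm_le_pi_norm (fun i => xi Am bm θ ω i t) i).trans (hξ t)
  refine ⟨⟨hx, ⟨Cm, hCm⟩, ?_, ?_, ?_, hρb, fun i => ⟨B, fun t => ?_⟩, ?_, fun i => ⟨Bξ, hξi i⟩,
    fun i => ?_, hm⟩, hlim⟩
  · obtain ⟨C, hC⟩ := hu
    refine ⟨C, fun t => ?_⟩
    rw [hcl.control, ← stack_dotProduct_stack]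
    exact hC t
  · obtain ⟨C, hC⟩ := hθb
    exact ⟨C, fun t => (norm_le_norm_stack k₁ k₂ t).1.trans (hC t)⟩
  · obtain ⟨C, hC⟩ := hθb
    exact ⟨C, fun t => (norm_le_norm_stack k₁ k₂ t).2.trans (hC t)⟩
  · exact (pi_norm_le_iff_of_nonneg ((norm_nonneg _).trans (hB 0 0))).2 fun j =>
      (norm_le_pi_norm (response Am bm (fun τ => ω τ j) t) i).trans (hB j t)
  · exact hAm.boundedSignal hu fun t => rfl
  · obtain ⟨R, hR⟩ := hρb
    refine ⟨Ce + R * Bξ, fun t => (norm_add_le _ _).trans (add_le_add ?_ ?_)⟩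
    · exact (norm_le_pi_norm _ i).trans (hCe' t)
    · rw [norm_mul]
      exact mul_le_mul (hR t) (hξi i t) (norm_nonneg _) ((norm_nonneg _).trans (hR t))
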